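/- Let $\mathbb F$ be a field with $|\mathbb F|=2$ and let $E$ be an $\mathbb F$-vector space with a countably infinite Hamel basis $(e_n)_{n<\omega}$. For $x\in E$ let $\operatorname{supp}(x)\subseteq\omega$ be the set of indices with non-zero coefficient, and for non-zero $x,y$ write $x<y$ if $\max\operatorname{supp}(x)<\min\operatorname{supp}(y)$. A block sequence is a $<$-increasing sequence of non-zero vectors; $E^{[\infty]}$ and $E^{[<\infty]}$ are the sets of infinite and of finite block sequences, and $\langle\cdot\rangle$ denotes linear span. For $A=(x_n)_{n<\omega}\in E^{[\infty]}$ put $A/N=(x_n)_{n\ge N}$ and $r_n(A)=(x_i)_{i<n}$. Write $A\le B$ if $\langle A\rangle\subseteq\langle B\rangle$, and $A\le^* B$ if $A/N\le B$ for some $N$. For a finite block sequence $a$ let $d_A(a)$ be the least $N$ such that every vector of $a$ is $<$ every vector of $A/N$. Let $\mathcal H\subseteq E^{[\infty]}$. * $\mathcal H$ is a *semicoideal* if $A\in\mathcal H$ and $A\le^*B$ imply $B\in\mathcal H$. It is a *coideal* if moreover for all $Y\subseteq E$ and $A\in\mathcal H$ there is $B\in\mathcal H$ with $B\le A$ and either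 $\langle B\rangle\setminus\{0\}\subseteq Y$ or $\langle B\rangle\setminus\{0\}\subseteq E\setminus Y$. A *filter* is a semicoideal any two elements $A,B$ of which have a common lower bound $C\le A,B$ in it. An *ultrafilter* is a coideal that is a filter. * A semicoideal $\mathcal H$ is *selective* if for every $A\in\mathcal H$ and every $\le$-decreasing sequence $(A_n)_{n<\omega}$ in $\mathcal H$ with $A_0\le A$ there is $B\in\mathcal H$ with $B\le A$ and $B/n\le A_{d_A(r_n(B))}$ for all $n$. * For $a\in E^{[<\infty]}$ let $[a,A]$ be the set of all $B\le A$ that have $a$ as an initial segment. If $\langle a\rangle\subseteq\langle A\rangle$, let $\mathcal{AR}{\upharpoonright}[a,A]$ be the set of all $b\in E^{[<\infty]}$ that have $a$ as an initial segment and satisfy $\langle b\rangle\subseteq\langle A\rangle$. A family $(\mathcal D_b)_{b\in\mathcal{AR}\upharpoonright[a,A]}$ is *dense open below $[a,A]$ in $\mathcal H$* if each $\mathcal D_b$ is a $\le$-downward closed subset of $\mathcal H\cap[b,A]$ and for every $B\in\mathcal H\cap[b,A]$ there is $C\in\mathcal H\cap[b,B]$ with $C\in\mathcal D_b$. A semicoideal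 $\mathcal H$ is *semiselective* if for all $A\in\mathcal H$, all $a\in E^{[<\infty]}$ with $\langle a\rangle\subseteq\langle A\rangle$ and every such family there is $B\in\mathcal H\cap[a,A]$ such that for every $b\in\mathcal{AR}{\upharpoonright}[a,A]$ there is $A_b\in\mathcal D_b$ with $[b,B]\subseteq[b,A_b]$. * A forcing poset is *$\sigma$-distributive* if the intersection of any countable family of dense open subsets is dense open. **Proposition.** Let $\mathcal H\subseteq E^{[\infty]}$ be a coideal. The following are equivalent: 1. $\mathcal H$ is semiselective. 2. The forcing poset $(\mathcal H,\le^*)$ is $\sigma$-distributive, and every $(\mathcal H,\le^*)$-generic filter $\mathcal U$ over the ground model $\mathbf V$ is a selective ultrafilter in $\mathbf V[\mathcal U]$; that is, every condition of $(\mathcal H,\le^*)$ forces that the canonical generic filter is a selective ultrafilter. -/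

import Mathlib

/-! ### Block sequences -/

section BlockSequences

variable {F : Type*} [Field F] {E : Type*} [AddCommGroup E] [Module F E]

/-- `x < y` for non-zero vectors: `max (supp x) < min (supp y)`, where the support is taken with
respect to the fixed Hamel basis `e`. -/
def Before (e : Module.Basis ℕ F E) (x y : E) : Prop :=
  ∀ i ∈ (e.repr x).support, ∀ j ∈ (e.repr y).support, i < j

/-- Infinite block sequences, that is, the elements of `E^[∞]`. -/
structure BlockSeq (e : Module.Basis ℕ F E) where
  seq : ℕ → E
  ne_zero : ∀ n, seq n ≠ 0
  before : ∀ m n, m < n → Before e (seq m) (seq n)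

/-- Finite block sequences, that is, the elements of `E^[<∞]`. -/
structure FinBlockSeq (e : Module.Basis ℕ F E) where
  seq : List E
  ne_zero : ∀ x ∈ seq, x ≠ 0
  before : seq.Pairwise (Before e)

variable {e : Module.Basis ℕ F E}

namespace BlockSeq

/-- `⟨A⟩`, the linear span of `A`. -/
def span (A : BlockSeq e) : Submodule F E := Submodule.span F (Set.range A.seq)

/-- The tail `A/N = (x_n)_{n ≥ N}`. -/
def tail (A : BlockSeq e) (N : ℕ) : BlockSeq e where
  seq n := A.seq (N + n)
  ne_zero n := A.ne_zero _
  before m n h := A.before _ _ (by omega)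

/-- `A ≤ B` iff `⟨A⟩ ⊆ ⟨B⟩`. -/
def Le (A B : BlockSeq e) : Prop := A.span ≤ B.span

/-- `A ≤* B` iff `A/N ≤ B` for some `N`. -/
def LeStar (A B : BlockSeq e) : Prop := ∃ N, (A.tail N).Le B

/-- `r_n(A) = (x_0, …, x_{n-1})`, as a list. -/
def initial (A : BlockSeq e) (n : ℕ) : List E := (List.range n).map A.seq

theorem le_refl (A : BlockSeq e) : A.Le A := _root_.le_refl A.span

theorem Le.trans {A B C : BlockSeq e} (h : A.Le B) (h' : B.Le C) : A.Le C :=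
  _root_.le_trans h h'

theorem seq_mem_span (A : BlockSeq e) (n : ℕ) : A.seq n ∈ A.span :=
  Submodule.subset_span ⟨n, rfl⟩

theorem tail_le (A : BlockSeq e) (N : ℕ) : (A.tail N).Le A := by
  refine Submodule.span_le.2 ?_
  rintro _ ⟨n, rfl⟩
  exact A.seq_mem_span _

theorem leStar_refl (A : BlockSeq e) : A.LeStar A := ⟨0, A.tail_le 0⟩

/-- The supports in a block sequence tend to infinity. -/
theorem le_of_mem_support (A : BlockSeq e) (n : ℕ) :
    ∀ i ∈ (e.repr (A.seq n)).support, n ≤ i := by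
  induction n with
  | zero => intro i _; exact Nat.zero_le i
  | succ n ih =>
    intro i hi
    have hne : (e.repr (A.seq n)).support.Nonempty := by
      rw [Finsupp.support_nonempty_iff]
      simpa using A.ne_zero n
    obtain ⟨j, hj⟩ := hne
    have h1 := ih j hj
    have h2 := A.before n (n + 1) (Nat.lt_succ_self n) j hj i hi
    omega

/-- A vector of `⟨B⟩` that lies beyond the first `M` blocks of `B` is in `⟨B/M⟩`. -/
theorem mem_span_tail (B : BlockSeq e) (M : ℕ) {x : E} (hx : x ∈ B.span)
    (hb : ∀ m < M, Before e (B.seq m) x) : x ∈ (B.tail M).span := by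
  classical
  have hsplit : B.span ≤ Submodule.span F (B.seq '' Set.Iio M) ⊔ (B.tail M).span := by
    refine Submodule.span_le.2 ?_
    rintro _ ⟨n, rfl⟩
    rcases lt_or_ge n M with h | h
    · exact Submodule.mem_sup_left (Submodule.subset_span ⟨n, h, rfl⟩)
    · refine Submodule.mem_sup_right (Submodule.subset_span ⟨n - M, ?_⟩)
      change B.seq (M + (n - M)) = B.seq n
      congr 1
      omega
  obtain ⟨u, hu, v, hv, rfl⟩ := Submodule.mem_sup.1 (hsplit hx)
  -- coordinates used by the first `M` blocks
  let S : Set ℕ := {i | ∃ m < M, i ∈ (e.repr (B.seq m)).support}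
  have hu' : ∀ i, i ∉ S → e.repr u i = 0 := by
    intro i hi
    have : Submodule.span F (B.seq '' Set.Iio M) ≤ LinearMap.ker (e.coord i) := by
      refine Submodule.span_le.2 ?_
      rintro _ ⟨m, hm, rfl⟩
      by_contra hne
      exact hi ⟨m, hm, Finsupp.mem_support_iff.2 (by simpa using hne)⟩
    simpa using this hu
  have hv' : ∀ i ∈ S, e.repr v i = 0 := by
    rintro i ⟨m, hm, hi⟩
    have : (B.tail M).span ≤ LinearMap.ker (e.coord i) := by
      refine Submodule.span_le.2 ?_
      rintro _ ⟨n, rfl⟩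
      by_contra hne
      have := B.before m (M + n) (by omega) i hi i
        (Finsupp.mem_support_iff.2 (by simpa [BlockSeq.tail] using hne))
      omega
    simpa using this hv
  have hu0 : u = 0 := by
    apply e.repr.injective
    ext i
    by_cases hi : i ∈ S
    · obtain ⟨m, hm, him⟩ := hi
      by_contra hne
      have : i ∈ (e.repr (u + v)).support := by
        rw [Finsupp.mem_support_iff, map_add, Finsupp.add_apply, hv' i ⟨m, hm, him⟩, add_zero]
        simpa using hne
      exact absurd (hb m hm i him i this) (lt_irrefl _)
    · simpa using hu' i hi
  simpa [hu0] using hv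

theorem LeStar.trans {A B C : BlockSeq e} (h : A.LeStar B) (h' : B.LeStar C) : A.LeStar C := by
  classical
  obtain ⟨N, hN⟩ := h
  obtain ⟨M, hM⟩ := h'
  let K : ℕ := (Finset.range M).sup fun m => (e.repr (B.seq m)).support.sup id
  refine ⟨N + K + 1, ?_⟩
  refine Submodule.span_le.2 ?_
  rintro _ ⟨n, rfl⟩
  refine hM (B.mem_span_tail M ?_ ?_)
  · have h3 := hN ((A.tail N).seq_mem_span (K + 1 + n))
    have h4 : (A.tail N).seq (K + 1 + n) = (A.tail (N + K + 1)).seq n := by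
      change A.seq _ = A.seq _
      congr 1
      omega
    rwa [h4] at h3
  · intro m hm i hi j hj
    have h1 : i ≤ K := le_trans (Finset.le_sup (f := id) hi)
      (Finset.le_sup (f := fun m => (e.repr (B.seq m)).support.sup id) (Finset.mem_range.2 hm))
    have h2 := A.le_of_mem_support (N + K + 1 + n) j hj
    omega

end BlockSeq

namespace FinBlockSeq

/-- `⟨a⟩`, the linear span of `a`. -/
def span (a : FinBlockSeq e) : Submodule F E := Submodule.span F {x | x ∈ a.seq}

/-- `a ∈ AR↾A`. -/
def InAR (A : BlockSeq e) (a : FinBlockSeq e) : Prop := a.span ≤ A.span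

/-- `AR↾[a,A]`, the set of all `b ∈ AR↾A` that end-extend `a`. -/
def ARBelow (a : FinBlockSeq e) (A : BlockSeq e) : Set (FinBlockSeq e) :=
  {b | b.InAR A ∧ a.seq <+: b.seq}

end FinBlockSeq

/-- The Ellentuck neighbourhood `[a,A]`. -/
def ellentuck (a : FinBlockSeq e) (A : BlockSeq e) : Set (BlockSeq e) :=
  {B | B.Le A ∧ ∃ n, B.initial n = a.seq}

/-! ### Semicoideals, coideals and semiselectivity -/

/-- Semicoideals: `≤*`-upward closed subsets of `E^[∞]`. -/
def IsSemicoideal (H : Set (BlockSeq e)) : Prop :=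
  ∀ A B : BlockSeq e, A ∈ H → A.LeStar B → B ∈ H

/-- Coideals. As `0` lies in every span, the dichotomy concerns the non-zero vectors of `⟨B⟩`. -/
def IsCoideal (H : Set (BlockSeq e)) : Prop :=
  IsSemicoideal H ∧
    ∀ (Y : Set E) (A : BlockSeq e), A ∈ H → ∃ B ∈ H, B.Le A ∧
      ((∀ x ∈ B.span, x ≠ 0 → x ∈ Y) ∨ (∀ x ∈ B.span, x ≠ 0 → x ∉ Y))

/-- `{D_b}` for `b ∈ AR↾[a,A]` is dense open below `[a,A]` in `H`. -/
def IsDenseOpenBelow (H : Set (BlockSeq e)) (a : FinBlockSeq e) (A : BlockSeq e)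
    (D : FinBlockSeq e → Set (BlockSeq e)) : Prop :=
  ∀ b ∈ a.ARBelow A,
    D b ⊆ H ∩ ellentuck b A ∧
    (∀ B ∈ D b, ∀ C ∈ H ∩ ellentuck b A, C.Le B → C ∈ D b) ∧
    (∀ B ∈ H ∩ ellentuck b A, ∃ C ∈ H ∩ ellentuck b B, C ∈ D b)

/-- `H` is semiselective: for all `A ∈ H` and `a ∈ AR↾A`, every dense open family below `[a,A]`
in `H` is diagonalised by some `B ∈ H ∩ [a,A]`. -/
def IsSemiselective (H : Set (BlockSeq e)) : Prop :=
  ∀ A ∈ H, ∀ a : FinBlockSeq e, a.InAR A → ∀ D : FinBlockSeq e → Set (BlockSeq e),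
    IsDenseOpenBelow H a A D →
      ∃ B ∈ H ∩ ellentuck a A, ∀ b ∈ a.ARBelow A, ∃ C ∈ D b, ellentuck b B ⊆ ellentuck b C

/-- The forcing poset `(H, ≤*)`. -/
def AlmostOrder (H : Set (BlockSeq e)) := {A : BlockSeq e // A ∈ H}

instance (H : Set (BlockSeq e)) : Preorder (AlmostOrder H) where
  le p q := p.1.LeStar q.1
  le_refl p := p.1.leStar_refl
  le_trans _ _ _ h h' := h.trans h'

end BlockSequences

/-! ### Forcing -/

/-- A dense open subset of a forcing poset. -/
def IsDenseOpen {P : Type*} [Preorder P] (D : Set P) : Prop :=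
  (∀ p ∈ D, ∀ q ≤ p, q ∈ D) ∧ ∀ p, ∃ q ≤ p, q ∈ D

/-- `σ`-distributivity: countable intersections of dense open sets are dense (hence dense open). -/
def IsSigmaDistributive (P : Type*) [Preorder P] : Prop :=
  ∀ D : ℕ → Set P, (∀ n, IsDenseOpen (D n)) → IsDenseOpen (⋂ n, D n)

/-- Statements of the forcing language of `P`. A statement `φ` is represented by its forcing
relation `p ⊩ φ`: conditions below a condition forcing `φ` force `φ`, and `p ⊩ φ` as soon as the
conditions that force `φ` are dense below `p`. -/
structure FStatement (P : Type*) [Preorder P] where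
  forces : P → Prop
  mono : ∀ p q, q ≤ p → forces p → forces q
  dense : ∀ p, (∀ q ≤ p, ∃ r ≤ q, forces r) → forces p

/-- `p ⊩ φ`: the condition `p` forces the statement `φ`. -/
def Forces {P : Type*} [Preorder P] (p : P) (φ : FStatement P) : Prop := φ.forces p

infix:50 " ⊩ " => Forces

namespace FStatement

variable {P : Type*} [Preorder P]

/-- A statement about the ground model that is absolute. -/
def ground (c : Prop) : FStatement P where
  forces _ := c
  mono _ _ _ h := h
  dense p h := by obtain ⟨_, _, h⟩ := h p le_rfl; exact h

/-- `p ⊩ φ ∧ ψ` iff `p ⊩ φ` and `p ⊩ ψ`. -/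
def and (φ ψ : FStatement P) : FStatement P where
  forces p := φ.forces p ∧ ψ.forces p
  mono p q h h' := ⟨φ.mono p q h h'.1, ψ.mono p q h h'.2⟩
  dense p h := ⟨φ.dense p fun q hq => (h q hq).imp fun _ h => ⟨h.1, h.2.1⟩,
    ψ.dense p fun q hq => (h q hq).imp fun _ h => ⟨h.1, h.2.2⟩⟩

/-- `p ⊩ φ → ψ` iff every `q ≤ p` that forces `φ` forces `ψ`. -/
def imp (φ ψ : FStatement P) : FStatement P where
  forces p := ∀ q ≤ p, φ.forces q → ψ.forces q
  mono _ _ h h' r hr := h' r (le_trans hr h)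
  dense p h q hq hφ := ψ.dense q fun r hr => by
    obtain ⟨s, hs, h'⟩ := h r (le_trans hr hq)
    exact ⟨s, hs, h' s le_rfl (φ.mono q s (le_trans hs hr) hφ)⟩

/-- `p ⊩ ¬φ` iff no `q ≤ p` forces `φ`. -/
def not (φ : FStatement P) : FStatement P where
  forces p := ∀ q ≤ p, ¬ φ.forces q
  mono _ _ h h' r hr := h' r (le_trans hr h)
  dense p h q hq hφ := by
    obtain ⟨s, hs, h'⟩ := h q hq
    exact h' s le_rfl (φ.mono q s hs hφ)

/-- `p ⊩ ∃ i, φ i` iff it is dense below `p` to force some `φ i`. -/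
def ex {ι : Type*} (φ : ι → FStatement P) : FStatement P where
  forces p := ∀ q ≤ p, ∃ r ≤ q, ∃ i, (φ i).forces r
  mono _ _ h h' r hr := h' r (le_trans hr h)
  dense p h q hq := by
    obtain ⟨r, hr, h'⟩ := h q hq
    obtain ⟨s, hs, h''⟩ := h' r le_rfl
    exact ⟨s, le_trans hs hr, h''⟩

/-- `p ⊩ ∀ i, φ i` iff `p ⊩ φ i` for all `i`. -/
def all {ι : Type*} (φ : ι → FStatement P) : FStatement P where
  forces p := ∀ i, (φ i).forces p
  mono p q h h' i := (φ i).mono p q h (h' i)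
  dense p h i := (φ i).dense p fun q hq => (h q hq).imp fun _ h => ⟨h.1, h.2 i⟩

/-- `p ⊩ φ ∨ ψ` iff it is dense below `p` to force `φ` or to force `ψ`. -/
def or (φ ψ : FStatement P) : FStatement P where
  forces p := ∀ q ≤ p, ∃ r ≤ q, φ.forces r ∨ ψ.forces r
  mono _ _ h h' r hr := h' r (le_trans hr h)
  dense p h q hq := by
    obtain ⟨r, hr, h'⟩ := h q hq
    obtain ⟨s, hs, h''⟩ := h' r le_rfl
    exact ⟨s, le_trans hs hr, h''⟩

end FStatement

/-- A `P`-name for a subset of a ground-model set `X`: a set of pairs `(x, p)`. For a generic `G`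
its value is `{x | ∃ p ∈ G, (x, p) ∈ τ}`, and every subset of `X` in the generic extension is the
value of such a name. -/
def SetName (P X : Type*) := Set (X × P)

namespace SetName

variable {P : Type*} {X Y : Type*}

/-- The canonical name of a ground-model subset of `X`. -/
def check (S : Set X) : SetName P X := {z : X × P | z.1 ∈ S}

/-- The canonical name of the preimage of a set under a ground-model function. -/
def preimage (f : X → Y) (τ : SetName P Y) : SetName P X :=
  {z : X × P | Set.Mem τ (f z.1, z.2)}

variable [Preorder P]

/-- The statement `x ∈ τ`: `p ⊩ x ∈ τ` iff it is dense below `p` to be below some `s` with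
`(x, s) ∈ τ`. -/
def mem (τ : SetName P X) (x : X) : FStatement P where
  forces p := ∀ q ≤ p, ∃ r ≤ q, ∃ s, r ≤ s ∧ Set.Mem τ (x, s)
  mono _ _ h h' r hr := h' r (le_trans hr h)
  dense p h q hq := by
    obtain ⟨r, hr, h'⟩ := h q hq
    obtain ⟨s, hs, h''⟩ := h' r le_rfl
    exact ⟨s, le_trans hs hr, h''⟩

/-- The statement `σ = τ`. -/
def eq (σ τ : SetName P X) : FStatement P :=
  FStatement.all fun x => ((σ.mem x).imp (τ.mem x)).and ((τ.mem x).imp (σ.mem x))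

end SetName

/-! ### Block sequences and selective ultrafilters in the generic extension

The sets `ℕ`, `E` and the finite subsets of `E` are the same in the generic extension. Sequences
of vectors in the extension are given by names of their graphs, which are subsets of `ℕ × E`, and
sequences of sequences of vectors by names of subsets of `ℕ × ℕ × E`. -/

namespace Extension

open FStatement

variable {P : Type*} [Preorder P]
variable {F : Type*} [Field F] {E : Type*} [AddCommGroup E] [Module F E]

/-- "`A` is an infinite block sequence", that is, `A ∈ E^[∞]`. -/
def isBlockSeq (e : Module.Basis ℕ F E) (A : SetName P (ℕ × E)) : FStatement P :=
  (all fun n : ℕ => ex fun x : E =>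
      (A.mem (n, x)).and (all fun y : E => (A.mem (n, y)).imp (ground (y = x)))).and
  ((all fun n : ℕ => all fun x : E => (A.mem (n, x)).imp (ground (x ≠ 0))).and
  (all fun m : ℕ => all fun n : ℕ => all fun x : E => all fun y : E =>
      (ground (m < n)).imp
        ((A.mem (m, x)).imp ((A.mem (n, y)).imp (ground (Before e x y))))))

/-- "`x ∈ ⟨A⟩`": `x` is in the span of a finite set of vectors occurring in `A`. -/
def memSpan (F : Type*) [Field F] [Module F E] (A : SetName P (ℕ × E)) (x : E) : FStatement P :=
  ex fun S : Finset E => (ground (x ∈ Submodule.span F (S : Set E))).and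
    (all fun y : E => (ground (y ∈ S)).imp (ex fun n : ℕ => A.mem (n, y)))

/-- "`A ≤ B`". -/
def le (F : Type*) [Field F] [Module F E] (A B : SetName P (ℕ × E)) : FStatement P :=
  all fun x : E => (memSpan F A x).imp (memSpan F B x)

/-- The tail `A/N`. -/
def tail (A : SetName P (ℕ × E)) (N : ℕ) : SetName P (ℕ × E) :=
  A.preimage fun z => (N + z.1, z.2)

/-- "`A ≤* B`". -/
def leStar (F : Type*) [Field F] [Module F E] (A B : SetName P (ℕ × E)) : FStatement P :=
  ex fun N : ℕ => le F (tail A N) B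

/-- The `n`-th term of a sequence of sequences. -/
def term (A : SetName P (ℕ × ℕ × E)) (n : ℕ) : SetName P (ℕ × E) :=
  A.preimage fun z => (n, z)

/-- "`max (supp r_n(B)) < A/N`". -/
def initialBefore (e : Module.Basis ℕ F E) (A B : SetName P (ℕ × E)) (n N : ℕ) : FStatement P :=
  all fun i : ℕ => all fun x : E => all fun k : ℕ => all fun y : E =>
    (ground (i < n)).imp ((B.mem (i, x)).imp
      ((ground (N ≤ k)).imp ((A.mem (k, y)).imp (ground (Before e x y)))))

/-- "`d_A(r_n(B)) = N`": `N` is least with `max (supp r_n(B)) < A/N`. -/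
def depthEq (e : Module.Basis ℕ F E) (A B : SetName P (ℕ × E)) (n N : ℕ) : FStatement P :=
  (initialBefore e A B n N).and
    (all fun M : ℕ => (ground (M < N)).imp (initialBefore e A B n M).not)

variable {e : Module.Basis ℕ F E}

/-- "`A ∈ U`", for a name `U` of a set of ground-model block sequences: `A` equals some
ground-model block sequence in `U`. -/
def memFamily (U : SetName P (BlockSeq e)) (A : SetName P (ℕ × E)) : FStatement P :=
  ex fun B : BlockSeq e =>
    (U.mem B).and (A.eq (SetName.check {z : ℕ × E | z.2 = B.seq z.1}))

/-- "`U` is a semicoideal": it is `≤*`-upward closed in `E^[∞]`. -/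
def isSemicoideal (U : SetName P (BlockSeq e)) : FStatement P :=
  all fun A : SetName P (ℕ × E) => all fun B : SetName P (ℕ × E) =>
    (isBlockSeq e A).imp ((isBlockSeq e B).imp
      ((memFamily U A).imp ((leStar F A B).imp (memFamily U B))))

/-- "`U` is a coideal". -/
def isCoideal (U : SetName P (BlockSeq e)) : FStatement P :=
  (isSemicoideal U).and
    (all fun Y : SetName P E => all fun A : SetName P (ℕ × E) =>
      (isBlockSeq e A).imp ((memFamily U A).imp
        (ex fun B : SetName P (ℕ × E) =>
          (isBlockSeq e B).and ((memFamily U B).and ((le F B A).and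
            ((all fun x : E => (memSpan F B x).imp ((ground (x ≠ 0)).imp (Y.mem x))).or
              (all fun x : E =>
                (memSpan F B x).imp ((ground (x ≠ 0)).imp (Y.mem x).not))))))))

/-- "`U` is a filter": a semicoideal in which any two elements have a common `≤`-lower bound. -/
def isFilter (U : SetName P (BlockSeq e)) : FStatement P :=
  (isSemicoideal U).and
    (all fun A : SetName P (ℕ × E) => all fun B : SetName P (ℕ × E) =>
      (isBlockSeq e A).imp ((isBlockSeq e B).imp ((memFamily U A).imp ((memFamily U B).imp
        (ex fun C : SetName P (ℕ × E) =>
          (isBlockSeq e C).and ((memFamily U C).and ((le F C A).and (le F C B))))))))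

/-- "`U` is an ultrafilter": a coideal and a filter. -/
def isUltrafilter (U : SetName P (BlockSeq e)) : FStatement P :=
  (isCoideal U).and (isFilter U)

/-- "`B` diagonalises `(A_n)` within `A`": `B/n ≤ A_{d_A(r_n(B))}` for all `n`. -/
def diagonalises (e : Module.Basis ℕ F E) (A : SetName P (ℕ × E)) (As : SetName P (ℕ × ℕ × E))
    (B : SetName P (ℕ × E)) : FStatement P :=
  all fun n : ℕ => all fun N : ℕ =>
    (depthEq e A B n N).imp (le F (tail B n) (term As N))

/-- "`U` is selective": for all `A ∈ U`, every `≤`-decreasing sequence `(A_n)` of elements of `U`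
below `A` is diagonalised within `A` by some `B ∈ U` with `B ≤ A`. -/
def isSelective (U : SetName P (BlockSeq e)) : FStatement P :=
  all fun A : SetName P (ℕ × E) => all fun As : SetName P (ℕ × ℕ × E) =>
    (isBlockSeq e A).imp ((memFamily U A).imp
      ((all fun n : ℕ => (isBlockSeq e (term As n)).and (memFamily U (term As n))).imp
        ((all fun n : ℕ => le F (term As (n + 1)) (term As n)).imp
          ((le F (term As 0) A).imp
            (ex fun B : SetName P (ℕ × E) =>
              (isBlockSeq e B).and ((memFamily U B).and
                ((le F B A).and (diagonalises e A As B))))))))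

/-- "`U` is a selective ultrafilter". -/
def isSelectiveUltrafilter (U : SetName P (BlockSeq e)) : FStatement P :=
  (isUltrafilter U).and (isSelective U)

/-- The canonical name `{(A, A) : A ∈ H}` of the `(H, ≤*)`-generic filter. -/
def genericFilter (H : Set (BlockSeq e)) : SetName (AlmostOrder H) (BlockSeq e) :=
  {z : BlockSeq e × AlmostOrder H | z.1 = z.2.1}

end Extension

/-! ### Combinatorics of block sequences -/

section BlockSequences

variable {F : Type*} [Field F] {E : Type*} [AddCommGroup E] [Module F E]
variable {e : Module.Basis ℕ F E}

/-! From semiselectivity to forcing. Applied to the empty stem, semiselectivity becomes a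
diagonalisation principle, `IsSemiselective.exists_diagonal`: a relation `R b T` that is hereditary
and dense in `T` holds along some `B`, that is, for each pair `r_n(B)`, `B/n`. Letting `R b T` say
that `T` lies in the dense open set of index `|b|` gives σ-distributivity, since `B ≤* B/n`. As `E`
is countable, the extension then has no new block sequences, no new sequences of them and no new
subsets of `E`. Below a suitable condition all names involved are decided (`DecidedAs`), and forced
statements about them reduce to ground-model ones. The ultrafilter clauses become density arguments
in `H`; selectivity is again the diagonalisation principle, with `R b T` saying `T ≤ A_N` for `N`
the depth of `b`.

From forcing to semiselectivity. Given a dense open family `D_b`, countably many `b` occur, so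
σ-distributivity yields one `Q` with `Q/μ(b) ≤ C_b ∈ D_b` for all `b`. The field being finite, only
finitely many `b` lie before a given block of `A`; hence `μ` has a bound `m(n)` on those before
block `n`. Selectivity applied to the decreasing sequence `Q/m(n)` gives `B` with `B/n ≤ Q/m(d)`,
`d` the depth of `r_n(B)` in `A`. Attaching a tail of `B` to `a` diagonalises the family: if `X ∈
[b, a⌢B/N]`, what follows `b` in `X` lies in some `B/n` for which the depth of `r_n(B)` bounds that
of `b`, hence below `C_b`. -/

theorem support_repr_nonempty {x : E} (hx : x ≠ 0) : (e.repr x).support.Nonempty := by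
  rw [Finsupp.support_nonempty_iff]
  simpa using hx

theorem Before.trans {x y z : E} (hy : y ≠ 0) (h : Before e x y) (h' : Before e y z) :
    Before e x z := by
  obtain ⟨k, hk⟩ := support_repr_nonempty (e := e) hy
  exact fun i hi j hj => (h i hi k hk).trans (h' k hk j hj)

namespace BlockSeq

theorem ext_seq {A B : BlockSeq e} (h : ∀ n, A.seq n = B.seq n) : A = B := by
  cases A; cases B
  congr 1
  exact funext h

theorem Le.leStar {A B : BlockSeq e} (h : A.Le B) : A.LeStar B := ⟨0, (A.tail_le 0).trans h⟩

theorem leStar_tail (A : BlockSeq e) (N : ℕ) : A.LeStar (A.tail N) := ⟨N, le_refl _⟩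

theorem tail_tail (A : BlockSeq e) (N M : ℕ) : (A.tail N).tail M = A.tail (N + M) :=
  ext_seq fun n => congrArg A.seq (Nat.add_assoc N M n).symm

theorem tail_antitone (A : BlockSeq e) {N M : ℕ} (h : N ≤ M) : (A.tail M).Le (A.tail N) := by
  obtain ⟨k, rfl⟩ := Nat.exists_eq_add_of_le h
  rw [← tail_tail]
  exact tail_le _ _

theorem le_iff {A B : BlockSeq e} : A.Le B ↔ ∀ n, A.seq n ∈ B.span := by
  refine ⟨fun h n => h (A.seq_mem_span n), fun h => Submodule.span_le.2 ?_⟩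
  rintro _ ⟨n, rfl⟩
  exact h n

theorem length_initial (A : BlockSeq e) (n : ℕ) : (A.initial n).length = n := by
  simp [initial]

theorem initial_eq_iff {A : BlockSeq e} {l : List E} :
    A.initial l.length = l ↔ ∀ (i : ℕ) (h : i < l.length), A.seq i = l[i] := by
  constructor
  · intro h i hi
    have := List.getElem_of_eq h (i := i) (by simpa [initial] using hi)
    rw [← this]
    simp [initial]
  · intro h
    refine List.ext_getElem (A.length_initial _) fun i h1 h2 => ?_
    rw [← h i h2]
    simp [initial]

theorem mem_initial {A : BlockSeq e} {n : ℕ} {x : E} :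
    x ∈ A.initial n ↔ ∃ i < n, A.seq i = x := by
  simp [initial]

/-- `r_n(A)` as a finite block sequence. -/
def restrict (A : BlockSeq e) (n : ℕ) : FinBlockSeq e where
  seq := A.initial n
  ne_zero x hx := by
    obtain ⟨i, -, rfl⟩ := mem_initial.1 hx
    exact A.ne_zero i
  before := by
    refine List.pairwise_map.2 ?_
    exact List.pairwise_lt_range.imp fun h => A.before _ _ h

theorem span_restrict_le (A : BlockSeq e) (n : ℕ) : (A.restrict n).span ≤ A.span := by
  refine Submodule.span_le.2 fun x hx => ?_
  obtain ⟨i, -, rfl⟩ := mem_initial.1 (show x ∈ A.initial n from hx)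
  exact A.seq_mem_span i

theorem exists_forall_before (A : BlockSeq e) (x : E) : ∃ N, ∀ n ≥ N, Before e x (A.seq n) := by
  refine ⟨(e.repr x).support.sup id + 1, fun n hn i hi j hj => ?_⟩
  have h1 : i ≤ (e.repr x).support.sup id := Finset.le_sup (f := id) hi
  have h2 := A.le_of_mem_support n j hj
  omega

theorem exists_forall_list_before (A : BlockSeq e) (l : List E) :
    ∃ N, ∀ n ≥ N, ∀ x ∈ l, Before e x (A.seq n) := by
  induction l with
  | nil => exact ⟨0, by simp⟩
  | cons y l ih =>
    obtain ⟨N, hN⟩ := ih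
    obtain ⟨M, hM⟩ := A.exists_forall_before y
    refine ⟨max N M, fun n hn x hx => ?_⟩
    rcases List.mem_cons.1 hx with rfl | hx
    · exact hM n (le_trans (le_max_right _ _) hn)
    · exact hN n (le_trans (le_max_left _ _) hn) x hx

/-- The terms of `A/n` lie beyond the first `n` blocks of `B`, because these are also the first
blocks of `A`; so `mem_span_tail` applies. -/
theorem tail_le_tail_of_initial_eq {A B : BlockSeq e} {n : ℕ} (h : A.Le B)
    (hn : A.initial n = B.initial n) : (A.tail n).Le (B.tail n) := by
  refine le_iff.2 fun i => B.mem_span_tail n (h (A.seq_mem_span _)) fun m hm => ?_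
  have : B.seq m = A.seq m := by
    have := List.getElem_of_eq hn (i := m) (by simpa [initial] using hm)
    simpa [initial] using this.symm
  rw [this]
  exact A.before _ _ (by omega)

theorem le_of_initial_of_tail {A B : BlockSeq e} {n : ℕ} (hi : ∀ i < n, A.seq i ∈ B.span)
    (h : (A.tail n).Le B) : A.Le B := by
  refine le_iff.2 fun i => ?_
  rcases lt_or_ge i n with hn | hn
  · exact hi i hn
  · obtain ⟨k, rfl⟩ := Nat.exists_eq_add_of_le hn
    exact le_iff.1 h k

/-- Every non-zero vector of `⟨B⟩` has a last block: it contains the support of this block and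
nothing beyond. -/
theorem exists_last_block (B : BlockSeq e) {x : E} (hx : x ∈ B.span) (h0 : x ≠ 0) :
    ∃ k, (e.repr (B.seq k)).support ⊆ (e.repr x).support ∧
      ∀ i ∈ (e.repr x).support, ∃ j ∈ (e.repr (B.seq k)).support, i ≤ j := by
  classical
  obtain ⟨c, rfl⟩ := Finsupp.mem_span_range_iff_exists_finsupp.1 hx
  have hc : c.support.Nonempty := by
    rw [Finsupp.support_nonempty_iff]
    rintro rfl
    simp at h0
  have hrepr : ∀ j, e.repr (c.sum fun i a => a • B.seq i) j =
      ∑ i ∈ c.support, c i * e.repr (B.seq i) j := by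
    intro j
    simp [Finsupp.sum, Finsupp.finsetSum_apply]
  -- The last block is the one of largest index with non-zero coefficient; supports of distinct
  -- blocks are disjoint, so nothing cancels.
  refine ⟨c.support.max' hc, fun j hj => ?_, fun i hi => ?_⟩
  · rw [Finsupp.mem_support_iff, hrepr, Finset.sum_eq_single (c.support.max' hc)]
    · exact mul_ne_zero (Finsupp.mem_support_iff.1 (c.support.max'_mem hc))
        (Finsupp.mem_support_iff.1 hj)
    · intro l hl hne
      by_contra hne'
      have hlt : l < c.support.max' hc := lt_of_le_of_ne (c.support.le_max' l hl) hne
      have := B.before _ _ hlt j (Finsupp.mem_support_iff.2 (right_ne_zero_of_mul hne')) j hj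
      exact lt_irrefl _ this
    · exact fun h => absurd (c.support.max'_mem hc) h
  · rw [Finsupp.mem_support_iff, hrepr] at hi
    obtain ⟨l, hl, hne⟩ := Finset.exists_ne_zero_of_sum_ne_zero hi
    have hil : i ∈ (e.repr (B.seq l)).support :=
      Finsupp.mem_support_iff.2 (right_ne_zero_of_mul hne)
    rcases (c.support.le_max' l hl).eq_or_lt with h | h
    · exact ⟨i, h ▸ hil, le_rfl⟩
    · obtain ⟨j, hj⟩ := support_repr_nonempty (e := e) (B.ne_zero (c.support.max' hc))
      exact ⟨j, hj, (B.before _ _ h i hil j hj).le⟩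

/-- A vector and its last block have the same maximum of support, and `Before` depends on its left
argument only through that maximum. -/
theorem exists_before_iff (B : BlockSeq e) {x : E} (hx : x ∈ B.span) (h0 : x ≠ 0) :
    ∃ k, ∀ z, Before e x z ↔ Before e (B.seq k) z := by
  obtain ⟨k, h1, h2⟩ := B.exists_last_block hx h0
  refine ⟨k, fun z => ⟨fun h i hi => h i (h1 hi), fun h i hi j hj => ?_⟩⟩
  obtain ⟨l, hl, hil⟩ := h2 i hi
  exact lt_of_le_of_lt hil (h l hl j hj)

theorem before_of_le {B : BlockSeq e} {k m : ℕ} (hm : m ≤ k) {z : E}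
    (h : Before e (B.seq k) z) : Before e (B.seq m) z := by
  rcases hm.eq_or_lt with rfl | hm
  · exact h
  · exact (B.before m k hm).trans (B.ne_zero k) h

end BlockSeq

/-! ### Ellentuck neighbourhoods and finite block sequences -/

theorem mem_ellentuck {a : FinBlockSeq e} {A X : BlockSeq e} :
    X ∈ ellentuck a A ↔ X.Le A ∧ X.initial a.seq.length = a.seq := by
  refine and_congr_right fun _ => ⟨?_, fun h => ⟨_, h⟩⟩
  rintro ⟨n, h⟩
  rw [← h, X.length_initial]

namespace FinBlockSeq

/-- `a ⌢ B`. -/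
def append (a : FinBlockSeq e) (B : BlockSeq e)
    (h : ∀ n, ∀ x ∈ a.seq, Before e x (B.seq n)) : BlockSeq e where
  seq n := if hn : n < a.seq.length then a.seq[n] else B.seq (n - a.seq.length)
  ne_zero n := by
    split_ifs with hn
    · exact a.ne_zero _ (List.getElem_mem hn)
    · exact B.ne_zero _
  before m n hmn := by
    by_cases hn : n < a.seq.length
    · have hm : m < a.seq.length := hmn.trans hn
      simpa [hm, hn] using List.pairwise_iff_getElem.1 a.before m n hm hn hmn
    · by_cases hm : m < a.seq.length
      · simpa [hm, hn] using h _ _ (List.getElem_mem hm)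
      · simpa [hm, hn] using B.before _ _ (by omega)

/-- Beyond any given bound, `T` has a tail that can be appended to `a`. -/
theorem exists_append (a : FinBlockSeq e) (T : BlockSeq e) (K : ℕ) :
    ∃ N ≥ K, ∃ C : BlockSeq e, C.initial a.seq.length = a.seq ∧
      C.tail a.seq.length = T.tail N := by
  obtain ⟨N, hN⟩ := T.exists_forall_list_before a.seq
  refine ⟨max K N, le_max_left _ _, a.append (T.tail (max K N)) fun n x hx =>
    hN _ ((le_max_right K N).trans (Nat.le_add_right _ _)) x hx, ?_, ?_⟩
  · refine BlockSeq.initial_eq_iff.2 fun i h => ?_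
    simp [append, h]
  · refine BlockSeq.ext_seq fun n => ?_
    simp [append, BlockSeq.tail]

theorem seq_mem_span {a : FinBlockSeq e} {X : BlockSeq e} (h : X.initial a.seq.length = a.seq)
    {i : ℕ} (hi : i < a.seq.length) : X.seq i ∈ a.span := by
  rw [BlockSeq.initial_eq_iff.1 h i hi]
  exact Submodule.subset_span (List.getElem_mem hi)

theorem nodup (a : FinBlockSeq e) : a.seq.Nodup := by
  refine a.before.imp_of_mem ?_
  rintro x y hx - h rfl
  obtain ⟨i, hi⟩ := support_repr_nonempty (e := e) (a.ne_zero x hx)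
  exact lt_irrefl _ (h i hi i hi)

theorem seq_injective : Function.Injective (FinBlockSeq.seq : FinBlockSeq e → List E) := by
  rintro ⟨l, _, _⟩ ⟨l', _, _⟩ rfl
  rfl

end FinBlockSeq

/-- Over a finite field there are only finitely many vectors with support below `k`. -/
theorem finite_support_subset_range [Finite F] (e : Module.Basis ℕ F E) (k : ℕ) :
    {x : E | ∀ i ∈ (e.repr x).support, i < k}.Finite := by
  refine Set.Finite.of_injOn (f := fun x => fun i : Fin k => e.repr x i) (t := Set.univ)
    (fun _ _ => Set.mem_univ _) ?_ Set.finite_univ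
  intro x hx y hy hxy
  apply e.repr.injective
  ext i
  by_cases hi : i < k
  · exact congrFun hxy ⟨i, hi⟩
  · have h1 : e.repr x i = 0 := by
      by_contra h
      exact hi (hx i (Finsupp.mem_support_iff.2 h))
    have h2 : e.repr y i = 0 := by
      by_contra h
      exact hi (hy i (Finsupp.mem_support_iff.2 h))
    rw [h1, h2]

/-- One index in the support of `z` bounds the supports of all vectors of `b`. So `b` is a
duplicate-free list over a finite set of vectors, and there are finitely many such lists. -/
theorem FinBlockSeq.finite_forall_before [Finite F] {z : E} (hz : z ≠ 0) :
    {b : FinBlockSeq e | ∀ x ∈ b.seq, Before e x z}.Finite := by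
  classical
  obtain ⟨k, hk⟩ := support_repr_nonempty (e := e) hz
  set S := {x : E | ∀ i ∈ (e.repr x).support, i < k}
  have hS : S.Finite := finite_support_subset_range e k
  have : Finite S := hS
  have := Fintype.ofFinite S
  refine Set.Finite.of_injOn (f := FinBlockSeq.seq)
    (t := (fun l : {l : List S // l.Nodup} => l.1.map Subtype.val) '' Set.univ)
    ?_ (FinBlockSeq.seq_injective.injOn) (Set.finite_univ.image _)
  intro b hb
  have hmem : ∀ x ∈ b.seq, x ∈ S := fun x hx i hi => hb x hx i hi k hk
  refine ⟨⟨b.seq.attachWith _ hmem, ?_⟩, Set.mem_univ _, ?_⟩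
  · exact List.Nodup.of_map Subtype.val (by simpa using b.nodup)
  · simp

theorem countable_of_basis_nat [Countable F] (e : Module.Basis ℕ F E) : Countable E :=
  e.repr.injective.countable

instance [Countable E] : Countable (FinBlockSeq e) :=
  FinBlockSeq.seq_injective.countable

/-! ### Semiselective diagonalisation -/

variable {H : Set (BlockSeq e)}

theorem IsSemicoideal.tail_mem (hS : IsSemicoideal H) {A : BlockSeq e} (hA : A ∈ H) (N : ℕ) :
    A.tail N ∈ H := hS _ _ hA (A.leStar_tail N)

theorem IsSemicoideal.mem_of_tail_mem (hS : IsSemicoideal H) {A : BlockSeq e} {N : ℕ}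
    (hA : A.tail N ∈ H) : A ∈ H := hS _ _ hA (A.tail_le N).leStar

/-- Semiselectivity with empty stem, freed of Ellentuck neighbourhoods: `D b` consists of the
members of `H ∩ [b,Q]` whose part after `b` satisfies `R b`. -/
theorem IsSemiselective.exists_diagonal (hS : IsSemicoideal H) (hH : IsSemiselective H)
    {Q : BlockSeq e} (hQ : Q ∈ H) (R : FinBlockSeq e → BlockSeq e → Prop)
    (hdown : ∀ b, ∀ T ∈ H, ∀ T' ∈ H, T'.Le T → R b T → R b T')
    (hdense : ∀ b, ∀ T ∈ H, T.Le Q → ∃ T' ∈ H, T'.Le T ∧ R b T') :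
    ∃ B ∈ H, B.Le Q ∧ ∀ n, R (B.restrict n) (B.tail n) := by
  let a : FinBlockSeq e := ⟨[], by simp, List.Pairwise.nil⟩
  let D : FinBlockSeq e → Set (BlockSeq e) := fun b =>
    {C | C ∈ H ∩ ellentuck b Q ∧ R b (C.tail b.seq.length)}
  have ha : a.InAR Q := by
    simp [FinBlockSeq.InAR, FinBlockSeq.span, a]
  have hD : IsDenseOpenBelow H a Q D := by
    intro b hb
    refine ⟨fun C hC => hC.1, ?_, ?_⟩
    · rintro B ⟨hB, hBR⟩ C hC hCB
      have h1 := (mem_ellentuck.1 hB.2).2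
      have h2 := (mem_ellentuck.1 hC.2).2
      exact ⟨hC, hdown b _ (hS.tail_mem hB.1 _) _ (hS.tail_mem hC.1 _)
        (BlockSeq.tail_le_tail_of_initial_eq hCB (h2.trans h1.symm)) hBR⟩
    · rintro B ⟨hB, hBQ⟩
      obtain ⟨hBQ, hBb⟩ := mem_ellentuck.1 hBQ
      obtain ⟨T, hT, hTB, hTR⟩ := hdense b _ (hS.tail_mem hB b.seq.length)
        ((BlockSeq.tail_le _ _).trans hBQ)
      -- Density gives a good `T` below the part of `B` after `b`; reattaching `b` to a tail of `T`
      -- returns to `[b,B]`, and `C ∈ H` because a tail of it is in `H`.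
      obtain ⟨N, -, C, hCb, hCT⟩ := b.exists_append T 0
      have hCH : C ∈ H := hS.mem_of_tail_mem (hCT ▸ hS.tail_mem hT N)
      have hCB : C.Le B := by
        refine BlockSeq.le_of_initial_of_tail (n := b.seq.length) (fun i hi => ?_) ?_
        · rw [BlockSeq.initial_eq_iff.1 hCb i hi, ← BlockSeq.initial_eq_iff.1 hBb i hi]
          exact B.seq_mem_span i
        · rw [hCT]
          exact ((T.tail_le N).trans hTB).trans (B.tail_le _)
      refine ⟨C, ⟨hCH, mem_ellentuck.2 ⟨hCB, hCb⟩⟩,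
        ⟨hCH, mem_ellentuck.2 ⟨hCB.trans hBQ, hCb⟩⟩, ?_⟩
      rw [hCT]
      exact hdown b _ hT _ (hS.tail_mem hT N) (T.tail_le N) hTR
  obtain ⟨B, ⟨hB, hBQ⟩, hBD⟩ := hH Q hQ a ha D hD
  refine ⟨B, hB, hBQ.1, fun n => ?_⟩
  obtain ⟨C, ⟨⟨hC, hCb⟩, hCR⟩, hBC⟩ := hBD (B.restrict n)
    ⟨(B.span_restrict_le n).trans hBQ.1, List.nil_prefix⟩
  have hlen : (B.restrict n).seq.length = n := B.length_initial n
  -- `B` itself belongs to `[r_n(B), B]`, hence `B ≤ C`.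
  have h1 := (hBC ⟨B.le_refl, n, rfl⟩).1
  have h2 := (mem_ellentuck.1 hCb).2
  rw [hlen] at hCR h2
  exact hdown _ _ (hS.tail_mem hC n) _ (hS.tail_mem hB n)
    (BlockSeq.tail_le_tail_of_initial_eq h1 h2.symm) hCR

/-- Diagonalise the relation `T ∈ D_{|b|}`. Then `B/n ∈ D n` for every `n`, and since `B ≤* B/n`,
openness puts `B` into all `D n`. -/
theorem IsSemiselective.isSigmaDistributive (hS : IsSemicoideal H) (hH : IsSemiselective H) :
    IsSigmaDistributive (AlmostOrder H) := by
  intro D hD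
  refine ⟨fun p hp q hq => Set.mem_iInter.2 fun n =>
    (hD n).1 p (Set.mem_iInter.1 hp n) q hq, fun p => ?_⟩
  obtain ⟨B, hB, hBp, hBD⟩ := hH.exists_diagonal hS p.2
    (fun b T => ∃ hT : T ∈ H, (⟨T, hT⟩ : AlmostOrder H) ∈ D b.seq.length)
    (fun b T _ T' hT' hle ⟨hT, h⟩ => ⟨hT', (hD _).1 _ h _ hle.leStar⟩)
    (fun b T hT _ => by
      obtain ⟨C, ⟨N, hN⟩, hC⟩ := (hD b.seq.length).2 ⟨T, hT⟩
      -- Density only gives `C ≤* T`; a tail of `C` is below `T` and stays in the open set.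
      exact ⟨C.1.tail N, hS.tail_mem C.2 N, hN, hS.tail_mem C.2 N,
        (hD _).1 _ hC _ (C.1.tail_le N).leStar⟩)
  refine ⟨⟨B, hB⟩, hBp.leStar, Set.mem_iInter.2 fun n => ?_⟩
  obtain ⟨hT, h⟩ := hBD n
  have hlen : (B.restrict n).seq.length = n := B.length_initial n
  rw [hlen] at h
  exact (hD n).1 _ h _ (B.leStar_tail n)

end BlockSequences

/-! ### Deciding statements of the forcing language -/

section Forcing

variable {P : Type*} [Preorder P]

namespace FStatement

variable {ι : Type*} {p : P} {φ ψ : FStatement P}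

theorem forces_and : (φ.and ψ).forces p ↔ φ.forces p ∧ ψ.forces p := Iff.rfl

theorem forces_imp : (φ.imp ψ).forces p ↔ ∀ q ≤ p, φ.forces q → ψ.forces q := Iff.rfl

theorem forces_all {φ : ι → FStatement P} : (all φ).forces p ↔ ∀ i, (φ i).forces p := Iff.rfl

theorem forces_ex {φ : ι → FStatement P} :
    (ex φ).forces p ↔ ∀ q ≤ p, ∃ r ≤ q, ∃ i, (φ i).forces r := Iff.rfl

theorem forces_or :
    (φ.or ψ).forces p ↔ ∀ q ≤ p, ∃ r ≤ q, φ.forces r ∨ ψ.forces r := Iff.rfl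

/-- Below `p`, the statement `φ` is equivalent to the ground-model proposition `c`. -/
def DecidedAs (p : P) (φ : FStatement P) (c : Prop) : Prop := ∀ q ≤ p, φ.forces q ↔ c

/-! ### Closure of decided statements under connectives and quantifiers -/

namespace DecidedAs

variable {c d : Prop}

theorem forces (h : DecidedAs p φ c) (hc : c) : φ.forces p := (h p le_rfl).2 hc

theorem of_forces (h : DecidedAs p φ c) (hφ : φ.forces p) : c := (h p le_rfl).1 hφ

theorem mono (h : DecidedAs p φ c) {q : P} (hq : q ≤ p) : DecidedAs q φ c :=
  fun r hr => h r (hr.trans hq)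

theorem congr (h : DecidedAs p φ c) (hcd : c ↔ d) : DecidedAs p φ d :=
  fun q hq => (h q hq).trans hcd

theorem ground (c : Prop) : DecidedAs p (FStatement.ground c) c := fun _ _ => Iff.rfl

theorem and (h : DecidedAs p φ c) (h' : DecidedAs p ψ d) : DecidedAs p (φ.and ψ) (c ∧ d) :=
  fun q hq => and_congr (h q hq) (h' q hq)

theorem imp (h : DecidedAs p φ c) (h' : DecidedAs p ψ d) : DecidedAs p (φ.imp ψ) (c → d) :=
  fun q hq => ⟨fun H hc => (h' q hq).1 (H q le_rfl ((h q hq).2 hc)),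
    fun H r hr hφ => (h' r (hr.trans hq)).2 (H ((h r (hr.trans hq)).1 hφ))⟩

theorem not (h : DecidedAs p φ c) : DecidedAs p φ.not (¬ c) :=
  fun q hq => ⟨fun H hc => H q le_rfl ((h q hq).2 hc),
    fun H r hr hφ => H ((h r (hr.trans hq)).1 hφ)⟩

theorem all {φ : ι → FStatement P} {c : ι → Prop} (h : ∀ i, DecidedAs p (φ i) (c i)) :
    DecidedAs p (FStatement.all φ) (∀ i, c i) :=
  fun q hq => forall_congr' fun i => h i q hq

theorem ex {φ : ι → FStatement P} {c : ι → Prop} (h : ∀ i, DecidedAs p (φ i) (c i)) :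
    DecidedAs p (FStatement.ex φ) (∃ i, c i) := by
  refine fun q hq => ⟨fun H => ?_, ?_⟩
  · obtain ⟨r, hr, i, hi⟩ := H q le_rfl
    exact ⟨i, (h i r (hr.trans hq)).1 hi⟩
  · rintro ⟨i, hi⟩ r hr
    exact ⟨r, le_rfl, i, (h i r (hr.trans hq)).2 hi⟩

end DecidedAs

end FStatement

open FStatement

namespace SetName

variable {X Y : Type*}

/-- Below `p`, the name `τ` is a name of the ground-model set `S`. -/
def DecidedAs (p : P) (τ : SetName P X) (S : Set X) : Prop :=
  ∀ x, FStatement.DecidedAs p (τ.mem x) (x ∈ S)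

variable {p : P} {τ : SetName P X} {S : Set X}

theorem DecidedAs.mono (h : DecidedAs p τ S) {q : P} (hq : q ≤ p) : DecidedAs q τ S :=
  fun x => (h x).mono hq

theorem decidedAs_check (p : P) (S : Set X) : DecidedAs p (SetName.check S) S := by
  refine fun x q _ => ⟨fun h => ?_, fun h r _ => ⟨r, le_rfl, r, le_rfl, h⟩⟩
  obtain ⟨_, _, _, _, h⟩ := h q le_rfl
  exact h

theorem DecidedAs.preimage {τ : SetName P Y} {S : Set Y} (h : DecidedAs p τ S) (f : X → Y) :
    DecidedAs p (τ.preimage f) (f ⁻¹' S) := fun x => h (f x)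

theorem forces_eq_check : (τ.eq (SetName.check S)).forces p ↔ DecidedAs p τ S := by
  constructor
  · intro h x q hq
    obtain ⟨h1, h2⟩ := h x
    have hS := decidedAs_check q S x q le_rfl
    exact ⟨fun h' => hS.1 (h1 q hq h'), fun h' => h2 q hq (hS.2 h')⟩
  · intro h x
    exact (((h x).imp (decidedAs_check p S x)).and
      ((decidedAs_check p S x).imp (h x))).forces ⟨id, id⟩

end SetName

/-- In a `σ`-distributive poset, countably many open sets that are dense below `p` can be met
simultaneously below `p`. -/
theorem IsSigmaDistributive.exists_le (hP : IsSigmaDistributive P) {ι : Type*} [Countable ι]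
    (p : P) (D : ι → P → Prop) (hopen : ∀ i r, D i r → ∀ s ≤ r, D i s)
    (hdense : ∀ i, ∀ r ≤ p, ∃ s ≤ r, D i s) : ∃ q ≤ p, ∀ i, D i q := by
  rcases isEmpty_or_nonempty ι with hι | hι
  · exact ⟨p, le_rfl, isEmptyElim⟩
  obtain ⟨f, hf⟩ := exists_surjective_nat ι
  -- Conditions incompatible with `p` are added to make the sets dense everywhere.
  have h := hP (fun n => {r | D (f n) r ∨ ∀ s ≤ r, ¬ s ≤ p}) fun n => by
    refine ⟨?_, fun r => ?_⟩
    · rintro r (hr | hr) s hs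
      · exact Or.inl (hopen _ r hr s hs)
      · exact Or.inr fun t ht => hr t (ht.trans hs)
    · by_cases hr : ∃ s ≤ r, s ≤ p
      · obtain ⟨s, hs, hsp⟩ := hr
        obtain ⟨t, ht, hD⟩ := hdense (f n) s hsp
        exact ⟨t, ht.trans hs, Or.inl hD⟩
      · exact ⟨r, le_rfl, Or.inr fun s hs hsp => hr ⟨s, hs, hsp⟩⟩
  obtain ⟨q, hq, hqD⟩ := h.2 p
  refine ⟨q, hq, fun i => ?_⟩
  obtain ⟨n, rfl⟩ := hf i
  exact (Set.mem_iInter.1 hqD n).resolve_right fun h => h q le_rfl hq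

/-- No new subsets of a countable set: each single membership is decided densely, and `exists_le`
decides all of them at once. -/
theorem IsSigmaDistributive.exists_decidedAs (hP : IsSigmaDistributive P) {X : Type*}
    [Countable X] (p : P) (τ : SetName P X) : ∃ q ≤ p, ∃ S, τ.DecidedAs q S := by
  obtain ⟨q, hq, h⟩ := hP.exists_le p
    (fun x r => (τ.mem x).forces r ∨ (τ.mem x).not.forces r)
    (fun x r h s hs => h.imp ((τ.mem x).mono r s hs) ((τ.mem x).not.mono r s hs))
    (fun x r _ => by
      by_cases h : ∃ s ≤ r, (τ.mem x).forces s
      · obtain ⟨s, hs, h⟩ := h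
        exact ⟨s, hs, Or.inl h⟩
      · exact ⟨r, le_rfl, Or.inr fun s hs hx => h ⟨s, hs, hx⟩⟩)
  refine ⟨q, hq, {x | (τ.mem x).forces q}, fun x r hr => ⟨fun h' => ?_, (τ.mem x).mono q r hr⟩⟩
  exact (h x).resolve_right fun h'' => h'' r hr h'

end Forcing

/-! ### Evaluating the notions of the extension at names of ground-model block sequences -/

namespace BlockSeq

variable {F : Type*} [Field F] {E : Type*} [AddCommGroup E] [Module F E]
variable {e : Module.Basis ℕ F E}

/-- The graph of a block sequence. -/
def graph (A : BlockSeq e) : Set (ℕ × E) := {z | z.2 = A.seq z.1}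

/-- `max (supp r_n(B)) < A/N`. -/
def InitialBefore (A B : BlockSeq e) (n N : ℕ) : Prop :=
  ∀ i < n, ∀ k ≥ N, Before e (B.seq i) (A.seq k)

/-- `d_A(r_n(B)) = N`. -/
def DepthEq (A B : BlockSeq e) (n N : ℕ) : Prop :=
  InitialBefore A B n N ∧ ∀ M < N, ¬ InitialBefore A B n M

theorem exists_depthEq (A B : BlockSeq e) (n : ℕ) : ∃ N, DepthEq A B n N := by
  classical
  have h : ∃ N, InitialBefore A B n N := by
    obtain ⟨N, hN⟩ := A.exists_forall_list_before (B.initial n)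
    exact ⟨N, fun i hi k hk => hN k hk _ (mem_initial.2 ⟨i, hi, rfl⟩)⟩
  exact ⟨Nat.find h, Nat.find_spec h, fun M hM => Nat.find_min h hM⟩

end BlockSeq

namespace Extension

open FStatement

variable {P : Type*} [Preorder P]
variable {F : Type*} [Field F] {E : Type*} [AddCommGroup E] [Module F E]
variable {e : Module.Basis ℕ F E} {p : P}

theorem forces_isBlockSeq {A : SetName P (ℕ × E)} {A₀ : BlockSeq e}
    (h : A.DecidedAs p A₀.graph) : (isBlockSeq e A).forces p := by
  refine DecidedAs.forces (DecidedAs.and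
    (.all fun n => .ex fun x => .and (h (n, x)) (.all fun y => .imp (h (n, y)) (.ground _)))
    (.and (.all fun n => .all fun x => .imp (h (n, x)) (.ground _))
      (.all fun m => .all fun n => .all fun x => .all fun y => .imp (.ground _)
        (.imp (h (m, x)) (.imp (h (n, y)) (.ground _)))))) ⟨?_, ?_, ?_⟩
  · exact fun n => ⟨A₀.seq n, rfl, fun y hy => hy⟩
  · intro n x (hx : x = A₀.seq n)
    exact hx ▸ A₀.ne_zero n
  · intro m n x y hmn (hx : x = A₀.seq m) (hy : y = A₀.seq n)
    exact hx ▸ hy ▸ A₀.before m n hmn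

/-- Spans are finitary, so membership is witnessed by a finite ground-model set of terms. -/
theorem decidedAs_memSpan {A : SetName P (ℕ × E)} {A₀ : BlockSeq e}
    (h : A.DecidedAs p A₀.graph) (x : E) : DecidedAs p (memSpan F A x) (x ∈ A₀.span) := by
  refine DecidedAs.congr (.ex fun S => .and (.ground _)
    (.all fun y => .imp (.ground _) (.ex fun n => h (n, y)))) ⟨?_, fun hx => ?_⟩
  · rintro ⟨S, hx, hS⟩
    refine Submodule.span_le.2 (fun y hy => ?_) hx
    obtain ⟨n, hn⟩ := hS y hy
    have hn : y = A₀.seq n := hn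
    exact hn ▸ A₀.seq_mem_span n
  · obtain ⟨T, hT, hx⟩ := Submodule.mem_span_finite_of_mem_span hx
    refine ⟨T, hx, fun y hy => ?_⟩
    obtain ⟨n, hn⟩ := hT hy
    exact ⟨n, hn.symm⟩

theorem decidedAs_le {A B : SetName P (ℕ × E)} {A₀ B₀ : BlockSeq e}
    (hA : A.DecidedAs p A₀.graph) (hB : B.DecidedAs p B₀.graph) :
    DecidedAs p (le F A B) (A₀.Le B₀) :=
  .all fun x => .imp (decidedAs_memSpan hA x) (decidedAs_memSpan hB x)

theorem decidedAs_tail {A : SetName P (ℕ × E)} {A₀ : BlockSeq e}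
    (h : A.DecidedAs p A₀.graph) (N : ℕ) : (tail A N).DecidedAs p (A₀.tail N).graph :=
  h.preimage _

theorem decidedAs_leStar {A B : SetName P (ℕ × E)} {A₀ B₀ : BlockSeq e}
    (hA : A.DecidedAs p A₀.graph) (hB : B.DecidedAs p B₀.graph) :
    DecidedAs p (leStar F A B) (A₀.LeStar B₀) :=
  .ex fun N => decidedAs_le (decidedAs_tail hA N) hB

theorem decidedAs_initialBefore {A B : SetName P (ℕ × E)} {A₀ B₀ : BlockSeq e}
    (hA : A.DecidedAs p A₀.graph) (hB : B.DecidedAs p B₀.graph) (n N : ℕ) :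
    DecidedAs p (initialBefore e A B n N) (A₀.InitialBefore B₀ n N) := by
  refine DecidedAs.congr (.all fun i => .all fun x => .all fun k => .all fun y =>
    .imp (.ground _) (.imp (hB (i, x)) (.imp (.ground _) (.imp (hA (k, y)) (.ground _)))))
    ⟨fun h i hi k hk => h i _ k _ hi rfl hk rfl, ?_⟩
  intro h i x k y hi (hx : x = B₀.seq i) hk (hy : y = A₀.seq k)
  exact hx ▸ hy ▸ h i hi k hk

theorem decidedAs_depthEq {A B : SetName P (ℕ × E)} {A₀ B₀ : BlockSeq e}
    (hA : A.DecidedAs p A₀.graph) (hB : B.DecidedAs p B₀.graph) (n N : ℕ) :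
    DecidedAs p (depthEq e A B n N) (A₀.DepthEq B₀ n N) :=
  .and (decidedAs_initialBefore hA hB n N)
    (.all fun M => .imp (.ground _) (.not (decidedAs_initialBefore hA hB n M)))

theorem decidedAs_diagonalises {A B : SetName P (ℕ × E)} {As : SetName P (ℕ × ℕ × E)}
    {A₀ B₀ : BlockSeq e} {C : ℕ → BlockSeq e}
    (hA : A.DecidedAs p A₀.graph) (hAs : ∀ n, (term As n).DecidedAs p (C n).graph)
    (hB : B.DecidedAs p B₀.graph) :
    DecidedAs p (diagonalises e A As B)
      (∀ n N, A₀.DepthEq B₀ n N → (B₀.tail n).Le (C N)) :=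
  .all fun n => .all fun N => .imp (decidedAs_depthEq hA hB n N)
    (decidedAs_le (decidedAs_tail hB n) (hAs N))

/-- In a `σ`-distributive extension every block sequence is a ground-model one. -/
theorem exists_decidedAs_graph (hP : IsSigmaDistributive P) [Countable E]
    {A : SetName P (ℕ × E)} (h : (isBlockSeq e A).forces p) :
    ∃ q ≤ p, ∃ A₀ : BlockSeq e, A.DecidedAs q A₀.graph := by
  obtain ⟨q, hq, S, hS⟩ := hP.exists_decidedAs p A
  obtain ⟨h1, h2, h3⟩ := (DecidedAs.and
    (.all fun n => .ex fun x => .and (hS (n, x)) (.all fun y => .imp (hS (n, y)) (.ground _)))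
    (.and (.all fun n => .all fun x => .imp (hS (n, x)) (.ground _))
      (.all fun m => .all fun n => .all fun x => .all fun y => .imp (.ground _)
        (.imp (hS (m, x)) (.imp (hS (n, y)) (.ground _)))))).of_forces
    ((isBlockSeq e A).mono p q hq h)
  choose f hf hf' using h1
  refine ⟨q, hq, ⟨f, fun n => h2 n _ (hf n), fun m n hmn => h3 m n _ _ hmn (hf m) (hf n)⟩, ?_⟩
  have : S = {z : ℕ × E | z.2 = f z.1} := by
    ext ⟨n, x⟩
    exact ⟨hf' n x, fun hx => (show x = f n from hx) ▸ hf n⟩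
  rw [this] at hS
  exact hS

/-! ### The generic filter -/

variable {H : Set (BlockSeq e)} {p : AlmostOrder H}

/-- A condition `r ≤* B` forces `B` into the generic filter, because `H` is upward closed and `B` is
thus itself a condition. Conversely, `B` is forced in only by way of conditions below it. -/
theorem forces_memFamily_iff (hS : IsSemicoideal H) {A : SetName (AlmostOrder H) (ℕ × E)} :
    (memFamily (genericFilter H) A).forces p ↔
      ∀ q ≤ p, ∃ r ≤ q, ∃ B : BlockSeq e, r.1.LeStar B ∧ A.DecidedAs r B.graph := by
  constructor
  · intro h q hq
    obtain ⟨r, hr, B, hB, hAB⟩ := h q hq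
    obtain ⟨s, hs, t, hst, ht⟩ := hB r le_rfl
    have ht : B = t.1 := ht
    exact ⟨s, hs.trans hr, B, ht ▸ hst, (SetName.forces_eq_check.1 hAB).mono hs⟩
  · intro h q hq
    obtain ⟨r, hr, B, hB, hAB⟩ := h q hq
    exact ⟨r, hr, B, fun s hs => ⟨s, le_rfl, ⟨B, hS _ _ r.2 hB⟩, le_trans hs hB, rfl⟩,
      SetName.forces_eq_check.2 hAB⟩

theorem forces_memFamily (hS : IsSemicoideal H) {A : SetName (AlmostOrder H) (ℕ × E)}
    {B : BlockSeq e} (hB : p.1.LeStar B) (hA : A.DecidedAs p B.graph) :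
    (memFamily (genericFilter H) A).forces p :=
  (forces_memFamily_iff hS).2 fun q hq => ⟨q, le_rfl, B, BlockSeq.LeStar.trans hq hB, hA.mono hq⟩

theorem exists_of_forces_memFamily (hS : IsSemicoideal H)
    {A : SetName (AlmostOrder H) (ℕ × E)} (h : (memFamily (genericFilter H) A).forces p) :
    ∃ r ≤ p, ∃ B : BlockSeq e, r.1.LeStar B ∧ A.DecidedAs r B.graph :=
  (forces_memFamily_iff hS).1 h p le_rfl

theorem forces_isSemicoideal [Countable E] (hS : IsSemicoideal H)
    (hP : IsSigmaDistributive (AlmostOrder H)) (p : AlmostOrder H) :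
    (isSemicoideal (genericFilter H)).forces p := by
  simp only [isSemicoideal, forces_all, forces_imp]
  intro A B q₁ _ _ q₂ h₂ hB q₃ h₃ hA q₄ h₄ hAB
  refine FStatement.dense _ q₄ fun q hq => ?_
  obtain ⟨r, hr, A₀, hrA, hA₀⟩ := exists_of_forces_memFamily hS
    ((memFamily _ A).mono _ _ (hq.trans h₄) hA)
  obtain ⟨s, hs, B₀, hB₀⟩ := exists_decidedAs_graph hP
    ((isBlockSeq e B).mono _ _ (hr.trans (hq.trans (h₄.trans h₃))) hB)
  have hle := (decidedAs_leStar (hA₀.mono hs) hB₀).of_forces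
    ((leStar F A B).mono _ _ (hs.trans (hr.trans hq)) hAB)
  exact ⟨s, hs.trans hr, forces_memFamily hS (BlockSeq.LeStar.trans hs (hrA.trans hle)) hB₀⟩

/-- Once `Y` and `A` are decided, the dichotomy of `H` in the ground model yields a homogeneous `B`,
which is itself a condition and forces itself into the generic filter. -/
theorem forces_isCoideal [Countable E] (hH : IsCoideal H)
    (hP : IsSigmaDistributive (AlmostOrder H)) (p : AlmostOrder H) :
    (isCoideal (genericFilter H)).forces p := by
  refine forces_and.2 ⟨forces_isSemicoideal hH.1 hP p, ?_⟩
  simp only [forces_all, forces_imp, forces_ex]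
  intro Y A q₁ _ _ q₂ h₂ hA q hq
  obtain ⟨r, hr, A₀, ⟨N, hN⟩, hA₀⟩ := exists_of_forces_memFamily hH.1
    ((memFamily _ A).mono _ _ hq hA)
  obtain ⟨s, hs, Y₀, hY₀⟩ := hP.exists_decidedAs r Y
  obtain ⟨M, hM⟩ : s.1.LeStar A₀ := BlockSeq.LeStar.trans hs ⟨N, hN⟩
  -- Working inside the tail `s/M` makes `B ≤ A₀` hold outright, not just modulo a tail.
  obtain ⟨B, hB, hBs, hBY⟩ := hH.2 Y₀ _ (hH.1.tail_mem s.2 M)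
  obtain ⟨t, rfl⟩ : ∃ t : AlmostOrder H, t.1 = B := ⟨⟨B, hB⟩, rfl⟩
  have hts : t ≤ s := (hBs.trans (s.1.tail_le M)).leStar
  have hBn := SetName.decidedAs_check t t.1.graph
  refine ⟨t, hts.trans (hs.trans hr), SetName.check t.1.graph,
    forces_and.2 ⟨forces_isBlockSeq hBn, forces_and.2 ⟨forces_memFamily hH.1 t.1.leStar_refl hBn,
    forces_and.2 ⟨(decidedAs_le hBn (hA₀.mono (hts.trans hs))).forces (hBs.trans hM), ?_⟩⟩⟩⟩
  refine forces_or.2 fun q' hq' => ⟨q', le_rfl, ?_⟩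
  have hBn' := hBn.mono hq'
  have hY := hY₀.mono (hq'.trans hts)
  exact hBY.imp
    (DecidedAs.all fun x => .imp (decidedAs_memSpan hBn' x) (.imp (.ground _) (hY x))).forces
    (DecidedAs.all fun x => .imp (decidedAs_memSpan hBn' x)
      (.imp (.ground _) (.not (hY x)))).forces

/-- A condition that is `≤*` both sequences has a tail that is `≤` both, and the condition forces
this tail into the generic filter. -/
theorem forces_isFilter [Countable E] (hS : IsSemicoideal H)
    (hP : IsSigmaDistributive (AlmostOrder H)) (p : AlmostOrder H) :
    (isFilter (genericFilter H)).forces p := by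
  refine forces_and.2 ⟨forces_isSemicoideal hS hP p, ?_⟩
  simp only [forces_all, forces_imp, forces_ex]
  intro A B q₁ _ _ q₂ h₂ _ q₃ h₃ hA q₄ h₄ hB q hq
  obtain ⟨r, hr, A₀, hrA, hA₀⟩ := exists_of_forces_memFamily hS
    ((memFamily _ A).mono _ _ (hq.trans h₄) hA)
  obtain ⟨s, hs, B₀, ⟨N, hN⟩, hB₀⟩ := exists_of_forces_memFamily hS
    ((memFamily _ B).mono _ _ (hr.trans hq) hB)
  obtain ⟨M, hM⟩ : s.1.LeStar A₀ := BlockSeq.LeStar.trans hs hrA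
  have hCn := SetName.decidedAs_check s (s.1.tail (max N M)).graph
  refine ⟨s, hs.trans hr, SetName.check (s.1.tail (max N M)).graph,
    forces_and.2 ⟨forces_isBlockSeq hCn,
    forces_and.2 ⟨forces_memFamily hS (s.1.leStar_tail _) hCn, forces_and.2
      ⟨(decidedAs_le hCn (hA₀.mono hs)).forces ?_, (decidedAs_le hCn hB₀).forces ?_⟩⟩⟩⟩
  · exact (s.1.tail_antitone (le_max_right N M)).trans hM
  · exact (s.1.tail_antitone (le_max_left N M)).trans hN

theorem forces_isSelective [Countable E] (hS : IsSemicoideal H) (hH : IsSemiselective H)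
    (p : AlmostOrder H) : (isSelective (genericFilter H)).forces p := by
  have hP := hH.isSigmaDistributive hS
  simp only [isSelective, forces_all, forces_imp, forces_ex, forces_and]
  intro A As q₁ _ _ q₂ h₂ hA q₃ h₃ hAs q₄ h₄ _ q₅ h₅ _ q hq
  obtain ⟨r, hr, A₀, hrA, hA₀⟩ := exists_of_forces_memFamily hS
    ((memFamily _ A).mono _ _ (hq.trans (h₅.trans (h₄.trans h₃))) hA)
  -- All terms of the sequence are decided by a single condition.
  obtain ⟨s, hs, hsC⟩ := hP.exists_le r
    (fun n t => ∃ C : BlockSeq e, t.1.LeStar C ∧ (term As n).DecidedAs t C.graph)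
    (fun n t ⟨C, htC, hC⟩ u hu => ⟨C, BlockSeq.LeStar.trans hu htC, hC.mono hu⟩)
    (fun n t ht => exists_of_forces_memFamily hS
      ((memFamily _ _).mono _ _ (ht.trans (hr.trans (hq.trans (h₅.trans h₄)))) (hAs n).2))
  choose C hsC hC using hsC
  obtain ⟨M, hM⟩ : s.1.LeStar A₀ := BlockSeq.LeStar.trans hs hrA
  -- The relation says `T ≤ C N` for `N = d_{A₀}(b)`. It is dense because `s ≤* C N`, so that a tail
  -- of any `T ≤ s` is below `C N`.
  obtain ⟨B, hB, hBs, hBC⟩ := hH.exists_diagonal hS (hS.tail_mem s.2 M)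
    (fun b T => ∀ N, (∀ k ≥ N, ∀ x ∈ b.seq, Before e x (A₀.seq k)) →
      (∀ K < N, ¬ ∀ k ≥ K, ∀ x ∈ b.seq, Before e x (A₀.seq k)) → T.Le (C N))
    (fun b T _ T' _ hle h N h1 h2 => hle.trans (h N h1 h2)) (by
      intro b T hT hTs
      by_cases hb : ∃ N, (∀ k ≥ N, ∀ x ∈ b.seq, Before e x (A₀.seq k)) ∧
        ∀ K < N, ¬ ∀ k ≥ K, ∀ x ∈ b.seq, Before e x (A₀.seq k)
      · obtain ⟨N, h1, h2⟩ := hb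
        obtain ⟨K, hK⟩ := BlockSeq.LeStar.trans (hTs.trans (s.1.tail_le M)).leStar (hsC N)
        refine ⟨T.tail K, hS.tail_mem hT K, T.tail_le K, fun N' h1' h2' => ?_⟩
        obtain rfl : N' = N := by
          rcases lt_trichotomy N' N with h | h | h
          · exact absurd h1' (h2 _ h)
          · exact h
          · exact absurd h1 (h2' _ h)
        exact hK
      · exact ⟨T, hT, T.le_refl, fun N h1 h2 => absurd ⟨N, h1, h2⟩ hb⟩)
  obtain ⟨t, rfl⟩ : ∃ t : AlmostOrder H, t.1 = B := ⟨⟨B, hB⟩, rfl⟩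
  have hts : t ≤ s := (hBs.trans (s.1.tail_le M)).leStar
  have hBn := SetName.decidedAs_check t t.1.graph
  refine ⟨t, hts.trans (hs.trans hr), SetName.check t.1.graph, forces_isBlockSeq hBn,
    forces_memFamily hS t.1.leStar_refl hBn,
    (decidedAs_le hBn (hA₀.mono (hts.trans hs))).forces (hBs.trans hM),
    (decidedAs_diagonalises (hA₀.mono (hts.trans hs)) (fun n => (hC n).mono hts) hBn).forces ?_⟩
  have hiff : ∀ n K, (∀ k ≥ K, ∀ x ∈ (t.1.restrict n).seq, Before e x (A₀.seq k)) ↔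
      A₀.InitialBefore t.1 n K := by
    refine fun n K => ⟨fun h i hi k hk => h k hk _ (BlockSeq.mem_initial.2 ⟨i, hi, rfl⟩), ?_⟩
    intro h k hk x hx
    obtain ⟨i, hi, rfl⟩ := BlockSeq.mem_initial.1 hx
    exact h i hi k hk
  exact fun n N hN => hBC n N ((hiff n N).2 hN.1) fun K hK h => hN.2 K hK ((hiff n K).1 h)

/-! ### Semiselectivity from a selective generic filter -/

/-- Selectivity of the generic filter, read off in the ground model. -/
theorem exists_diagonal_of_forces_isSelective (hS : IsSemicoideal H) {A : BlockSeq e}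
    {C : ℕ → BlockSeq e} (h : (isSelective (genericFilter H)).forces p)
    (hA : p.1.LeStar A) (hpC : ∀ n, p.1.LeStar (C n)) (hC : ∀ n, (C (n + 1)).Le (C n))
    (hCA : (C 0).Le A) :
    ∃ B ∈ H, B.Le A ∧ ∀ n N, A.DepthEq B n N → (B.tail n).Le (C N) := by
  have hAn := SetName.decidedAs_check p A.graph
  let As : SetName (AlmostOrder H) (ℕ × ℕ × E) :=
    SetName.check {z : ℕ × ℕ × E | z.2 ∈ (C z.1).graph}
  have hAsn : ∀ n, (term As n).DecidedAs p (C n).graph := fun n =>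
    (SetName.decidedAs_check p {z : ℕ × ℕ × E | z.2 ∈ (C z.1).graph}).preimage fun z => (n, z)
  simp only [isSelective, forces_all, forces_imp, forces_ex, forces_and] at h
  obtain ⟨r, hr, B, -, hB, hBA, hBd⟩ := h (SetName.check A.graph) As p le_rfl
    (forces_isBlockSeq hAn) p le_rfl (forces_memFamily hS hA hAn) p le_rfl
    (fun n => ⟨forces_isBlockSeq (hAsn n), forces_memFamily hS (hpC n) (hAsn n)⟩) p le_rfl
    (fun n => (decidedAs_le (hAsn (n + 1)) (hAsn n)).forces (hC n)) p le_rfl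
    ((decidedAs_le (hAsn 0) hAn).forces hCA) p le_rfl
  obtain ⟨s, hs, B₀, hsB, hB₀⟩ := exists_of_forces_memFamily hS hB
  have hsp := hs.trans hr
  exact ⟨B₀, hS _ _ s.2 hsB,
    (decidedAs_le hB₀ (hAn.mono hsp)).of_forces ((le F _ _).mono _ _ hs hBA),
    (decidedAs_diagonalises (hAn.mono hsp) (fun n => (hAsn n).mono hsp) hB₀).of_forces
      ((diagonalises e _ _ _).mono _ _ hs hBd)⟩

end Extension

/-! ### Diagonalising dense open families -/

section BlockSequences

variable {F : Type*} [Field F] {E : Type*} [AddCommGroup E] [Module F E]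
variable {e : Module.Basis ℕ F E} {H : Set (BlockSeq e)}

/-- Dense open families below `[a,A]` have a common `≤*`-lower bound below `A`. -/
theorem IsDenseOpenBelow.exists_leStar [Countable E] (hS : IsSemicoideal H)
    (hP : IsSigmaDistributive (AlmostOrder H)) {a : FinBlockSeq e} {A : BlockSeq e} (hA : A ∈ H)
    {D : FinBlockSeq e → Set (BlockSeq e)} (hD : IsDenseOpenBelow H a A D) :
    ∃ Q ∈ H, Q.LeStar A ∧ ∀ b ∈ a.ARBelow A, ∃ C ∈ D b, Q.LeStar C := by
  obtain ⟨q, hq, h⟩ := hP.exists_le (⟨A, hA⟩ : AlmostOrder H)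
    (fun (b : a.ARBelow A) r => ∃ C ∈ D b, r.1.LeStar C)
    (fun b r ⟨C, hC, hrC⟩ s hs => ⟨C, hC, BlockSeq.LeStar.trans hs hrC⟩)
    (fun b r hr => by
      obtain ⟨M, hM⟩ := hr
      -- Attaching `b` to a tail of `r` leads into `[b,A]`, where `D b` is dense, and changes `r`
      -- only modulo `≤*`.
      obtain ⟨N, -, B, hBb, hBT⟩ := b.1.exists_append (r.1.tail M) 0
      have hB : B ∈ H := hS.mem_of_tail_mem (hBT ▸ hS.tail_mem (hS.tail_mem r.2 M) N)
      have hBA : B.Le A := BlockSeq.le_of_initial_of_tail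
        (fun i hi => b.2.1 (FinBlockSeq.seq_mem_span hBb hi))
        (hBT ▸ ((BlockSeq.tail_le _ N).trans hM))
      obtain ⟨C, ⟨hC, hCB⟩, hCD⟩ := ((hD b b.2).2.2 B ⟨hB, mem_ellentuck.2 ⟨hBA, hBb⟩⟩)
      refine ⟨⟨C, hC⟩, ?_, C, hCD, C.leStar_refl⟩
      have h1 : B.LeStar r.1 := (B.leStar_tail b.1.seq.length).trans
        (hBT ▸ ((BlockSeq.tail_le _ N).trans (BlockSeq.tail_le _ M)).leStar)
      exact hCB.1.leStar.trans h1)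
  exact ⟨q.1, q.2, hq, fun b hb => h ⟨b, hb⟩⟩

/-- A tail of `a ⌢ B/N` beyond `b` is a tail of `B` whose depth bounds the depth of `b`. -/
theorem exists_tail_le_of_mem_ellentuck {a b : FinBlockSeq e} {B B' X : BlockSeq e} {N : ℕ}
    (hN : 0 < N) (haB : ∀ x ∈ a.seq, Before e x (B.seq (N - 1)))
    (hB'a : B'.initial a.seq.length = a.seq) (hB' : B'.tail a.seq.length = B.tail N)
    (hab : a.seq <+: b.seq) (hX : X ∈ ellentuck b B') :
    ∃ n > 0, (X.tail b.seq.length).Le (B.tail n) ∧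
      ∀ z, Before e (B.seq (n - 1)) z → ∀ x ∈ b.seq, Before e x z := by
  obtain ⟨hXB, hXb⟩ := mem_ellentuck.1 hX
  have hlen : a.seq.length ≤ b.seq.length := hab.length_le
  have hB'tail : ∀ j, B'.seq (a.seq.length + j) = B.seq (N + j) := fun j =>
    congrFun (congrArg BlockSeq.seq hB') j
  have hB'X : ∀ m < a.seq.length, B'.seq m = X.seq m := fun m hm => by
    rw [BlockSeq.initial_eq_iff.1 hB'a m hm, BlockSeq.initial_eq_iff.1 hXb m (hm.trans_le hlen)]
    exact hab.getElem hm
  have hbX : ∀ x ∈ b.seq, ∃ i < b.seq.length, X.seq i = x := fun x hx => by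
    rw [← hXb] at hx
    exact BlockSeq.mem_initial.1 hx
  -- it suffices to bound `b` by a block of `B'`
  have key : ∃ M ≥ a.seq.length, (∀ i ≥ b.seq.length, ∀ m < M, Before e (B'.seq m) (X.seq i)) ∧
      ∀ z, Before e (B.seq (N + (M - a.seq.length) - 1)) z → ∀ x ∈ b.seq, Before e x z := by
    rcases Nat.eq_zero_or_pos b.seq.length with h0 | h0
    · refine ⟨a.seq.length, le_rfl, fun i _ m hm => ?_, fun z _ x hx => ?_⟩
      · omega
      · rw [List.length_eq_zero_iff.1 h0] at hx
        simp at hx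
    -- Block `k` of `B'` is the last block occurring in the last vector of `b`.
    · obtain ⟨k, hk⟩ := B'.exists_before_iff (hXB (X.seq_mem_span (b.seq.length - 1)))
        (X.ne_zero _)
      refine ⟨max (k + 1) a.seq.length, le_max_right _ _, fun i hi m hm => ?_, ?_⟩
      · by_cases hm' : m < a.seq.length
        · rw [hB'X m hm']
          exact X.before _ _ (by omega)
        · exact BlockSeq.before_of_le (show m ≤ k by omega)
            ((hk _).1 (X.before _ _ (by omega)))
      · intro z hz x hx
        obtain ⟨i, hi, rfl⟩ := hbX x hx
        refine BlockSeq.before_of_le (show i ≤ b.seq.length - 1 by omega) ((hk z).2 ?_)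
        -- If this block belongs to `a`, the bound is the skipped block `B.seq (N - 1)`, which lies
        -- beyond `a`; hence `N > 0`.
        by_cases hka : k < a.seq.length
        · have h1 : N + (max (k + 1) a.seq.length - a.seq.length) - 1 = N - 1 := by omega
          rw [h1] at hz
          refine (haB _ ?_).trans (B.ne_zero _) hz
          rw [BlockSeq.initial_eq_iff.1 hB'a k hka]
          exact List.getElem_mem hka
        · have h1 : N + (max (k + 1) a.seq.length - a.seq.length) - 1 =
              N + (k - a.seq.length) := by omega
          rw [h1, ← hB'tail] at hz
          rwa [show a.seq.length + (k - a.seq.length) = k by omega] at hz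
  obtain ⟨M, hM, hMX, hMz⟩ := key
  refine ⟨N + (M - a.seq.length), by omega, ?_, hMz⟩
  rw [← B.tail_tail, ← hB', BlockSeq.tail_tail, show a.seq.length + (M - a.seq.length) = M by omega]
  exact BlockSeq.le_iff.2 fun i => B'.mem_span_tail M (hXB (X.seq_mem_span _))
    (hMX _ (Nat.le_add_right _ _))

/-- Selectivity controls how far along `Q` one must go in terms of the depth in `A`. This suffices
because over a finite field only finitely many `b` have a given depth. -/
theorem isSemiselective_of_forces [Finite F] (hS : IsSemicoideal H)
    (hP : IsSigmaDistributive (AlmostOrder H))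
    (hsel : ∀ p : AlmostOrder H,
      (Extension.isSelective (Extension.genericFilter H)).forces p) : IsSemiselective H := by
  classical
  intro A hA a haA D hD
  have : Countable E := countable_of_basis_nat e
  obtain ⟨Q, hQ, ⟨K, hK⟩, hQD⟩ := hD.exists_leStar hS hP hA
  have : Nonempty (BlockSeq e) := ⟨A⟩
  choose! C hCD hQC using hQD
  choose! μ hμ using hQC
  have hfin : ∀ n, {b : FinBlockSeq e | ∀ x ∈ b.seq, Before e x (A.seq n)}.Finite := fun n =>
    FinBlockSeq.finite_forall_before (A.ne_zero n)
  -- `m n` bounds `μ b` for all `b` of depth at most `n` in `A`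
  let m : ℕ → ℕ := fun n => K + (hfin n).toFinset.sup μ
  have hm : ∀ n, m n ≤ m (n + 1) := fun n => by
    refine Nat.add_le_add_left (Finset.sup_mono ?_) K
    refine (hfin n).toFinset_mono fun b hb x hx => ?_
    exact (hb x hx).trans (A.ne_zero n) (A.before _ _ n.lt_succ_self)
  -- As `Q` is `≤*` each of its tails, it forces all of them into the generic filter. The summand
  -- `K` in `m` puts `Q/m(0)` below `A`.
  obtain ⟨B, hB, hBA, hBd⟩ := Extension.exists_diagonal_of_forces_isSelective
    (C := fun n => Q.tail (m n)) hS (hsel ⟨Q, hQ⟩) ⟨K, hK⟩ (fun n => Q.leStar_tail _)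
    (fun n => Q.tail_antitone (hm n)) ((Q.tail_antitone (Nat.le_add_right K _)).trans hK)
  obtain ⟨N₀, hN₀⟩ := B.exists_forall_list_before a.seq
  -- The extra 1 ensures that `B.seq (N - 1)` already lies beyond `a`.
  obtain ⟨N, hN, B', hB'a, hB'⟩ := a.exists_append B (N₀ + 1)
  have hB'H : B' ∈ H := hS.mem_of_tail_mem (hB' ▸ hS.tail_mem hB N)
  have hB'A : B'.Le A := BlockSeq.le_of_initial_of_tail
    (fun i hi => haA (FinBlockSeq.seq_mem_span hB'a hi)) (hB' ▸ (B.tail_le N).trans hBA)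
  refine ⟨B', ⟨hB'H, mem_ellentuck.2 ⟨hB'A, hB'a⟩⟩, fun b hb => ⟨C b, hCD b hb, fun X hX => ?_⟩⟩
  obtain ⟨n, hn, hXn, hnz⟩ := exists_tail_le_of_mem_ellentuck (by omega)
    (hN₀ (N - 1) (by omega)) hB'a hB' hb.2 hX
  have hXb := (mem_ellentuck.1 hX).2
  have hCb := (mem_ellentuck.1 ((hD b hb).1 (hCD b hb)).2).2
  obtain ⟨d, hd⟩ := A.exists_depthEq B n
  -- `B.seq (n - 1)` is the last vector of `r_n(B)`, hence before `A.seq d`; so `b` is before `A.seq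
  -- d` too, and `μ b ≤ m d`.
  have hbd : b ∈ (hfin d).toFinset :=
    (hfin d).mem_toFinset.2 (hnz _ (hd.1 (n - 1) (by omega) d le_rfl))
  have hle : (X.tail b.seq.length).Le (C b) :=
    ((hXn.trans (hBd n d hd)).trans
      (Q.tail_antitone ((Finset.le_sup hbd).trans (Nat.le_add_left _ K)))).trans (hμ b hb)
  -- Both `X` and `C b` begin with `b`, so only the part of `X` after `b` mattered.
  refine mem_ellentuck.2 ⟨BlockSeq.le_of_initial_of_tail (fun i hi => ?_) hle, hXb⟩
  rw [BlockSeq.initial_eq_iff.1 hXb i hi, ← BlockSeq.initial_eq_iff.1 hCb i hi]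
  exact (C b).seq_mem_span i

end BlockSequences

/-- Every `(H, ≤*)`-generic filter has a property iff every condition of `(H, ≤*)` forces the
canonical generic filter to have it. -/
theorem mainTheorem10 {F : Type*} [Field F] (hF : Nat.card F = 2)
    {E : Type*} [AddCommGroup E] [Module F E] (e : Module.Basis ℕ F E)
    (H : Set (BlockSeq e)) (hH : IsCoideal H) :
    IsSemiselective H ↔
      (IsSigmaDistributive (AlmostOrder H) ∧
        ∀ p : AlmostOrder H,
          p ⊩ Extension.isSelectiveUltrafilter (Extension.genericFilter H)) := by
  have : Finite F := Nat.finite_of_card_ne_zero (by omega)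
  have : Countable E := countable_of_basis_nat e
  constructor
  · intro h
    have hP := h.isSigmaDistributive hH.1
    exact ⟨hP, fun p => FStatement.forces_and.2 ⟨FStatement.forces_and.2
      ⟨Extension.forces_isCoideal hH hP p, Extension.forces_isFilter hH.1 hP p⟩,
      Extension.forces_isSelective hH.1 h p⟩⟩
  · rintro ⟨hP, h⟩
    exact isSemiselective_of_forces hH.1 hP fun p => (FStatement.forces_and.1 (h p)).2
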